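/- Let $n\ge 1$ and let $\mathbb H^n=\mathbb C^n\times\mathbb R$ be the Heisenberg group, with group law $(z,t)\circ(w,s)=\left(z+w,\;t+s+\tfrac12\operatorname{Im}(z\cdot\overline w)\right)$, Korányi norm $\|(z,t)\|=(|z|^4+t^2)^{1/4}$, distance $\operatorname{dist}(p,q)=\|p^{-1}\circ q\|$, and homogeneous dimension $Q=2n+2$. Write $\mathfrak B_r(p)=\{q:\operatorname{dist}(p,q)<r\}$, let $\operatorname{diam}$ denote the diameter for this distance, and for $\rho>0$ let $B_\rho=\{(z,t)\in\mathbb H^n:|z|\le\rho,\ |t|\le\rho^2\}$. Let $F\subseteq\mathbb H^n$ be a measurable set with Lebesgue measure $|F|=1$, and let $\mu(A)=|A\cap F|$ be the probability measure obtained by restricting Lebesgue measure to $F$. Assume that there are constants $c_1,c_2>0$ such that $$c_1 r^Q\le \mu(\mathfrak B_r(p))\le c_2 r^Q\qquad\text{for all } p\in F \text{ and all } 0<r<\operatorname{diam}(F).$$ Then there exist a constant $C>0$ and an integer $N_0$ (both allowed to depend on $n$ and $F$) such that for every integer $N\ge N_0$ there is a finite sequence of points $\zeta_1,\dots,\zeta_N\in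 F$ for which the discrepancy $$D_N(z,t;\rho)=\sum_{j=1}^N\chi_{(z,t)\circ B_\rho}(\zeta_j)-N\mu\big((z,t)\circ B_\rho\big)$$ satisfies $$\int_0^{\operatorname{diam}(F)}\int_F\left|D_N(z,t;\rho)\right|^2\,dz\,dt\,d\rho\le C\,N^{1-\frac1Q}.$$ -/

import Mathlib

open MeasureTheory
open scoped ENNReal

noncomputable section

/-- The underlying space `ℂⁿ × ℝ` of the Heisenberg group `ℍⁿ`, with its coordinate structure. -/
def Heisenberg (n : ℕ) : Type := (Fin n → ℂ) × ℝ

namespace Heisenberg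

/-- Borel σ-algebra and Lebesgue measure of `ℂⁿ × ℝ`. -/
instance instMeasureSpace (n : ℕ) : MeasureSpace (Heisenberg n) :=
  inferInstanceAs (MeasureSpace ((Fin n → ℂ) × ℝ))

variable {n : ℕ}

/-- The `ℂⁿ`-component `z` of the point `(z, t)`. -/
def z (p : Heisenberg n) : Fin n → ℂ := p.1

/-- The `ℝ`-component `t` of the point `(z, t)`. -/
def t (p : Heisenberg n) : ℝ := p.2

/-- The point `(z, t)`. -/
def mk (z : Fin n → ℂ) (t : ℝ) : Heisenberg n := (z, t)

@[ext] theorem ext {p q : Heisenberg n} (hz : p.z = q.z) (ht : p.t = q.t) : p = q :=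
  Prod.ext hz ht

@[simp] theorem z_mk (z : Fin n → ℂ) (t : ℝ) : (mk z t).z = z := rfl

@[simp] theorem t_mk (z : Fin n → ℂ) (t : ℝ) : (mk z t).t = t := rfl

/-- The Hermitian product `z · w̄ = ∑ᵢ zᵢ w̄ᵢ` on `ℂⁿ`. -/
def herm (z w : Fin n → ℂ) : ℂ := ∑ i, z i * star (w i)

/-- The Euclidean norm `|z|` on `ℂⁿ`. -/
def cnorm (z : Fin n → ℂ) : ℝ := Real.sqrt (∑ i, ‖z i‖ ^ 2)

/-- The group law `(z,t) ∘ (w,s) = (z + w, t + s + ½ Im (z · w̄))`. -/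
instance instMul : Mul (Heisenberg n) :=
  ⟨fun p q => mk (p.z + q.z) (p.t + q.t + 1 / 2 * (herm p.z q.z).im)⟩

instance instOne : One (Heisenberg n) := ⟨mk 0 0⟩

instance instInv : Inv (Heisenberg n) := ⟨fun p => mk (-p.z) (-p.t)⟩

@[simp] theorem z_mul (p q : Heisenberg n) : (p * q).z = p.z + q.z := rfl

@[simp] theorem t_mul (p q : Heisenberg n) :
    (p * q).t = p.t + q.t + 1 / 2 * (herm p.z q.z).im := rfl

@[simp] theorem z_one : (1 : Heisenberg n).z = 0 := rfl

@[simp] theorem t_one : (1 : Heisenberg n).t = 0 := rfl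

@[simp] theorem z_inv (p : Heisenberg n) : (p⁻¹).z = -p.z := rfl

@[simp] theorem t_inv (p : Heisenberg n) : (p⁻¹).t = -p.t := rfl

theorem herm_add_left (a b c : Fin n → ℂ) : herm (a + b) c = herm a c + herm b c := by
  simp [herm, add_mul, Finset.sum_add_distrib]

theorem herm_add_right (a b c : Fin n → ℂ) : herm a (b + c) = herm a b + herm a c := by
  simp [herm, mul_add, Finset.sum_add_distrib]

theorem herm_neg_self_im (a : Fin n → ℂ) : (herm (-a) a).im = 0 := by
  simp only [herm, Complex.im_sum]
  refine Finset.sum_eq_zero fun i _ => ?_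
  simp [Complex.mul_im]
  ring

instance instGroup : Group (Heisenberg n) :=
  Group.ofLeftAxioms
    (fun a b c => by
      ext1
      · simp [add_assoc]
      · simp only [t_mul, z_mul, herm_add_left, herm_add_right, Complex.add_im]
        ring)
    (fun a => by
      ext1
      · simp
      · simp [herm])
    (fun a => by
      ext1
      · simp
      · simp [herm_neg_self_im])

/-- The Korányi norm `‖(z,t)‖ = (|z|⁴ + t²)^{1/4}`. -/
def koranyi (p : Heisenberg n) : ℝ := (cnorm p.z ^ 4 + p.t ^ 2) ^ (1 / 4 : ℝ)

/-- The left-invariant Korányi distance `dist(p, q) = ‖p⁻¹ ∘ q‖`. -/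
def kdist (p q : Heisenberg n) : ℝ := koranyi (p⁻¹ * q)

/-- The (open) Heisenberg ball of centre `p` and radius `r`. -/
def kball (p : Heisenberg n) (r : ℝ) : Set (Heisenberg n) := {q | kdist p q < r}

/-- The diameter of a set for the Korányi distance, with values in `[0, ∞]`. -/
def kdiam (F : Set (Heisenberg n)) : ℝ≥0∞ :=
  ⨆ p ∈ F, ⨆ q ∈ F, ENNReal.ofReal (kdist p q)

/-- The homogeneous dimension `Q = 2n + 2` of `ℍⁿ`. -/
def homDim (n : ℕ) : ℕ := 2 * n + 2

/-- The cylinder `B_ρ = {(z,t) : |z| ≤ ρ, |t| ≤ ρ²}`. -/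
def cyl (n : ℕ) (ρ : ℝ) : Set (Heisenberg n) := {p | cnorm p.z ≤ ρ ∧ |p.t| ≤ ρ ^ 2}

/-- The left translate `p ∘ B_ρ = {q : p⁻¹ ∘ q ∈ B_ρ}`. -/
def translatedCyl (p : Heisenberg n) (ρ : ℝ) : Set (Heisenberg n) := {q | p⁻¹ * q ∈ cyl n ρ}

/-- The discrepancy `D_N(p; ρ) = ∑ⱼ χ_{p ∘ B_ρ}(ζⱼ) - N μ(p ∘ B_ρ)` of the finite sequence `ζ`
with respect to the measure `μ`. -/
def discrepancy (μ : Measure (Heisenberg n)) {N : ℕ} (ζ : Fin N → Heisenberg n)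
    (p : Heisenberg n) (ρ : ℝ) : ℝ :=
  ∑ j, (translatedCyl p ρ).indicator (fun _ => (1 : ℝ)) (ζ j) - N * μ.real (translatedCyl p ρ)

/-- `μ` is lower and upper Ahlfors regular of dimension `Q` on `F`: for some `c₁, c₂ > 0`,
`c₁ r^Q ≤ μ(𝔅_r(p)) ≤ c₂ r^Q` for all `p ∈ F` and all `0 < r < diam F`. -/
def IsAhlforsRegularOn (μ : Measure (Heisenberg n)) (F : Set (Heisenberg n)) : Prop :=
  ∃ c₁ c₂ : ℝ, 0 < c₁ ∧ 0 < c₂ ∧ ∀ p ∈ F, ∀ r : ℝ, 0 < r → ENNReal.ofReal r < kdiam F →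
    ENNReal.ofReal (c₁ * r ^ homDim n) ≤ μ (kball p r) ∧
      μ (kball p r) ≤ ENNReal.ofReal (c₂ * r ^ homDim n)

/-- The quadratic discrepancy `∫_0^{diam F} ∫_F |D_N(z,t;ρ)|² dz dt dρ` of the finite sequence
`ζ`, with respect to Lebesgue measure restricted to `F`. -/
def quadDiscrepancy (F : Set (Heisenberg n)) {N : ℕ} (ζ : Fin N → Heisenberg n) : ℝ≥0∞ :=
  ∫⁻ ρ in {ρ : ℝ | 0 < ρ ∧ ENNReal.ofReal ρ < kdiam F}, ∫⁻ p in F,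
    ENNReal.ofReal (|discrepancy (volume.restrict F) ζ p ρ| ^ 2)

end Heisenberg

end

/-! The translated cylinders are the closed balls of a left-invariant metric, so the problem becomes
one about metric balls. Write `N μ` as a sum of `N` probability measures `ν j`, each carried by a
ball of radius `r j`, and draw `ζ j` from `ν j` independently: the mean square discrepancy at `(p,
ρ)` is the sum of the variances of the indicators. The `j`-th variance vanishes unless `ρ` is within
`r j` of the distance from `p` to the centre of the `j`-th ball, so it integrates to at most `2 r j`
over `ρ`, and some choice of points has quadratic discrepancy at most `2 ∑ r j`
(`exists_quadDiscrepancy_le`).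

It remains to make `∑ r j` of order `N^(1-1/Q)`. By regularity, `F` has nets of mesh `D/2^k` with
`O(2^(kQ))` points. Starting from the scale `2^(KQ) ~ N`, the mass in each ball is cut into unit
masses and the remainder, less than one, is passed to a neighbour in the next coarser net
(`hasUnitDecomposition_of_nets`). Level `k` thus receives at most one unit per point of net `k+1`,
at cost `O(2^(k(Q-1)))`; the geometric sum is dominated by the finest level, `2^(K(Q-1)) ~
N^(1-1/Q)`. -/

/-! ### Nets from packing bounds. -/

theorem exists_finset_net_of_card_le {X : Type*} [PseudoMetricSpace X] {F : Set X} {δ : ℝ} {M : ℕ} (hδ : 0 ≤ δ)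
    (h : ∀ s : Finset X, ↑s ⊆ F → (∀ x ∈ s, ∀ y ∈ s, x ≠ y → δ ≤ dist x y) → s.card ≤ M) :
    ∃ s : Finset X, ↑s ⊆ F ∧ s.card ≤ M ∧ ∀ y ∈ F, ∃ x ∈ s, dist y x ≤ δ := by
  classical
  let P : ℕ → Prop := fun c => ∃ s : Finset X, ↑s ⊆ F ∧
    (∀ x ∈ s, ∀ y ∈ s, x ≠ y → δ ≤ dist x y) ∧ s.card = c
  have hP0 : P 0 := ⟨∅, by simp, by simp, by simp⟩
  -- A separated set of largest cardinality is a net: an uncovered point could be added to it.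
  obtain ⟨s, hsF, hsep, hcard⟩ := Nat.findGreatest_spec (P := P) (Nat.zero_le M) hP0
  refine ⟨s, hsF, h s hsF hsep, fun y hy => ?_⟩
  by_contra! hcon
  have hyS : y ∉ s := fun hys => by simpa using hδ.trans_lt (hcon y hys)
  have hsep' : ∀ x ∈ insert y s, ∀ z ∈ insert y s, x ≠ z → δ ≤ dist x z := by
    intro x hx z hz hxz
    rcases Finset.mem_insert.1 hx with rfl | hx' <;> rcases Finset.mem_insert.1 hz with rfl | hz'
    · exact absurd rfl hxz
    · exact (hcon z hz').le
    · rw [dist_comm]; exact (hcon x hx').le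
    · exact hsep x hx' z hz' hxz
  have hF' : ↑(insert y s) ⊆ F := by
    rw [Finset.coe_insert]; exact Set.insert_subset hy hsF
  have := Nat.le_findGreatest (P := P) (h _ hF' hsep') ⟨_, hF', hsep', rfl⟩
  rw [Finset.card_insert_of_notMem hyS] at this
  omega

/-! ### Cutting a measure into unit masses on small balls. -/

section MassSplitting

variable {X : Type*} [PseudoMetricSpace X] [MeasurableSpace X]

/-- `κ` is a sum of `m` probability measures, each carried by a closed ball, where the radii of
the balls add up to at most `R`. -/
def HasUnitDecomposition (κ : Measure X) (m : ℕ) (R : ℝ) : Prop :=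
  ∃ (ν : Fin m → Measure X) (c : Fin m → X) (r : Fin m → ℝ),
    (∀ j, IsProbabilityMeasure (ν j)) ∧ (∀ j, ν j (Metric.closedBall (c j) (r j))ᶜ = 0) ∧
      (∀ j, 0 ≤ r j) ∧ ∑ j, r j ≤ R ∧ ∑ j, ν j = κ

theorem HasUnitDecomposition.zero {R : ℝ} (hR : 0 ≤ R) :
    HasUnitDecomposition (0 : Measure X) 0 R :=
  ⟨Fin.elim0, Fin.elim0, Fin.elim0, fun j => j.elim0, fun j => j.elim0, fun j => j.elim0,
    by simpa using hR, by simp⟩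

theorem HasUnitDecomposition.mono {κ : Measure X} {m : ℕ} {R R' : ℝ}
    (h : HasUnitDecomposition κ m R) (hR : R ≤ R') : HasUnitDecomposition κ m R' := by
  obtain ⟨ν, c, r, h1, h2, h3, h4, h5⟩ := h
  exact ⟨ν, c, r, h1, h2, h3, h4.trans hR, h5⟩

theorem HasUnitDecomposition.add {κ κ' : Measure X} {m m' : ℕ} {R R' : ℝ}
    (h : HasUnitDecomposition κ m R) (h' : HasUnitDecomposition κ' m' R') :
    HasUnitDecomposition (κ + κ') (m + m') (R + R') := by
  obtain ⟨ν, c, r, h1, h2, h3, h4, h5⟩ := h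
  obtain ⟨ν', c', r', h1', h2', h3', h4', h5'⟩ := h'
  refine ⟨Fin.append ν ν', Fin.append c c', Fin.append r r', ?_, ?_, ?_, ?_, ?_⟩
  · exact fun j => Fin.addCases (fun i => by simpa using h1 i) (fun i => by simpa using h1' i) j
  · exact fun j => Fin.addCases (fun i => by simpa using h2 i) (fun i => by simpa using h2' i) j
  · exact fun j => Fin.addCases (fun i => by simpa using h3 i) (fun i => by simpa using h3' i) j
  · simpa [Fin.sum_univ_add] using add_le_add h4 h4'
  · simp [Fin.sum_univ_add, h5, h5']

theorem HasUnitDecomposition.measure_univ {κ : Measure X} {m : ℕ} {R : ℝ}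
    (h : HasUnitDecomposition κ m R) : κ Set.univ = m := by
  obtain ⟨ν, c, r, h1, h2, h3, h4, rfl⟩ := h
  simp [Measure.finsetSum_apply]

/-- All pieces are multiples of `κ`: as many normalised copies as the integer part of the mass, then
the fractional rest. No partition of the space is needed. -/
theorem exists_unit_splitting (κ : Measure X) [IsFiniteMeasure κ] {x : X} {r : ℝ} (hr : 0 ≤ r)
    (hκ : κ (Metric.closedBall x r)ᶜ = 0) :
    ∃ (m : ℕ) (κ₁ κ₂ : Measure X), HasUnitDecomposition κ₁ m (m * r) ∧ κ = κ₁ + κ₂ ∧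
      κ₂ Set.univ < 1 ∧ κ₂ (Metric.closedBall x r)ᶜ = 0 := by
  by_cases h0 : κ = 0
  · exact ⟨0, 0, 0, .zero (by simp), by simp [h0], by simp, by simp⟩
  set M : NNReal := (κ Set.univ).toNNReal with hM
  have hMκ : κ Set.univ = M := (ENNReal.coe_toNNReal (measure_ne_top _ _)).symm
  have hM0 : M ≠ 0 := by
    intro h
    rw [h] at hMκ
    exact h0 (Measure.measure_univ_eq_zero.1 (by simpa using hMκ))
  have hfl : (⌊M⌋₊ : NNReal) ≤ M := Nat.floor_le zero_le
  have hsum : (⌊M⌋₊ : NNReal) * M⁻¹ + (M - ⌊M⌋₊) * M⁻¹ = 1 := by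
    rw [← add_mul, add_tsub_cancel_of_le hfl, mul_inv_cancel₀ hM0]
  refine ⟨⌊M⌋₊, ∑ _j : Fin ⌊M⌋₊, M⁻¹ • κ, ((M - ⌊M⌋₊) * M⁻¹) • κ,
    ⟨fun _ => M⁻¹ • κ, fun _ => x, fun _ => r, fun _ => ⟨?_⟩, fun _ => ?_, fun _ => hr,
      by simp, rfl⟩, ?_, ?_, ?_⟩
  · rw [Measure.smul_apply, hMκ, ENNReal.smul_def, smul_eq_mul, ← ENNReal.coe_mul,
      inv_mul_cancel₀ hM0, ENNReal.coe_one]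
  · simp [hκ]
  · rw [Finset.sum_const, Finset.card_univ, Fintype.card_fin, ← Nat.cast_smul_eq_nsmul NNReal,
      smul_smul, ← add_smul, hsum, one_smul]
  · rw [Measure.smul_apply, hMκ, ENNReal.smul_def, smul_eq_mul, ← ENNReal.coe_mul, mul_assoc,
      inv_mul_cancel₀ hM0, mul_one, ← ENNReal.coe_one, ENNReal.coe_lt_coe]
    exact (tsub_lt_iff_left hfl).2 (by simpa [add_comm] using Nat.lt_floor_add_one M)
  · simp [hκ]

theorem exists_unit_splitting_family (s : Finset X) (κ : X → Measure X)
    [∀ x, IsFiniteMeasure (κ x)] {r : ℝ} (hr : 0 ≤ r)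
    (hκ : ∀ x ∈ s, κ x (Metric.closedBall x r)ᶜ = 0) :
    ∃ (m : ℕ) (κ₁ : Measure X) (κ₂ : X → Measure X), HasUnitDecomposition κ₁ m (m * r) ∧
      ∑ x ∈ s, κ x = κ₁ + ∑ x ∈ s, κ₂ x ∧ (∀ x, κ₂ x Set.univ < 1) ∧
      ∀ x, κ₂ x (Metric.closedBall x r)ᶜ = 0 := by
  classical
  induction s using Finset.induction_on with
  | empty => exact ⟨0, 0, 0, .zero (by simp), by simp, by simp, by simp⟩
  | insert a s ha ih =>
    obtain ⟨m, κ₁, κ₂, h1, h2, h3, h4⟩ := ih fun x hx => hκ x (Finset.mem_insert_of_mem hx)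
    obtain ⟨m', κ₁', κ₂', h1', h2', h3', h4'⟩ :=
      exists_unit_splitting (κ a) hr (hκ a (Finset.mem_insert_self _ _))
    refine ⟨m' + m, κ₁' + κ₁, Function.update κ₂ a κ₂', ?_, ?_, ?_, ?_⟩
    · simpa [add_mul] using h1'.add h1
    · have : ∑ x ∈ s, Function.update κ₂ a κ₂' x = ∑ x ∈ s, κ₂ x :=
        Finset.sum_congr rfl fun x hx =>
          Function.update_of_ne (ne_of_mem_of_not_mem hx ha) _ _
      rw [Finset.sum_insert ha, Finset.sum_insert ha, this, h2, h2', Function.update_self]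
      abel
    · intro x
      by_cases hx : x = a
      · subst hx; simpa using h3'
      · simpa [hx] using h3 x
    · intro x
      by_cases hx : x = a
      · subst hx; simpa using h4'
      · simpa [hx] using h4 x

/-- Masses carried by balls around the points of a net are grouped into unit masses; what is left
over at one scale is handed to the next coarser net. -/
theorem hasUnitDecomposition_of_nets {F : Set X} {D : ℝ} (hD : 0 ≤ D) (s : ℕ → Finset X)
    (hs0 : (s 0).card = 1) (hsF : ∀ k, ↑(s k) ⊆ F)
    (hcov : ∀ k, ∀ y ∈ F, ∃ x ∈ s k, dist y x ≤ D / 2 ^ k) (k : ℕ) :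
    ∀ (κ : X → Measure X) (_ : ∀ x, IsFiniteMeasure (κ x)) (m : ℕ),
      (∀ x ∈ s k, κ x (Metric.closedBall x (2 * (D / 2 ^ k)))ᶜ = 0) →
      (∑ x ∈ s k, κ x) Set.univ = m →
      HasUnitDecomposition (∑ x ∈ s k, κ x) m (m * (2 * (D / 2 ^ k)) +
        ∑ i ∈ Finset.range k, ((s (i + 1)).card : ℝ) * (2 * (D / 2 ^ i))) := by
  classical
  induction k with
  | zero =>
    intro κ _ m hκ hm
    obtain ⟨m', κ₁, κ₂, h1, h2, h3, h4⟩ := exists_unit_splitting_family (s 0) κ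
      (r := 2 * (D / 2 ^ 0)) (by positivity) hκ
    obtain ⟨a, ha⟩ := Finset.card_eq_one.1 hs0
    rw [h2, Measure.add_apply, h1.measure_univ, ha, Finset.sum_singleton] at hm
    -- At the root there is a single remainder, of mass less than one; the total mass being an
    -- integer, it must vanish.
    have hmm : m' = m := by
      have ha1 := h3 a
      have h5 : (m' : ℝ≥0∞) ≤ m := hm ▸ le_self_add
      have h6 : (m : ℝ≥0∞) < m' + 1 := by
        rw [← hm]; exact ENNReal.add_lt_add_left (by simp) ha1
      have h5' : m' ≤ m := by exact_mod_cast h5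
      have h6' : m < m' + 1 := by exact_mod_cast h6
      omega
    subst hmm
    have h0 : κ₂ a = 0 := by
      rw [← Measure.measure_univ_eq_zero]
      exact (ENNReal.add_right_inj (by simp)).1 (hm.trans (add_zero _).symm)
    rw [h2, ha, Finset.sum_singleton, h0, add_zero]
    simpa using h1
  | succ k ih =>
    intro κ _ m hκ hm
    obtain ⟨m', κ₁, κ₂, h1, h2, h3, h4⟩ := exists_unit_splitting_family (s (k + 1)) κ
      (r := 2 * (D / 2 ^ (k + 1))) (by positivity) hκ
    have hfin : ∀ x, IsFiniteMeasure (κ₂ x) := fun x => ⟨(h3 x).trans ENNReal.one_lt_top⟩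
    choose! π hπs hπ using hcov k
    have hmaps : ∀ y ∈ s (k + 1), π y ∈ s k := fun y hy => hπs y (hsF _ hy)
    -- Each remainder moves to the parent `π y` of its centre.
    set κ' : X → Measure X := fun x => ∑ y ∈ s (k + 1) with π y = x, κ₂ y with hκ'
    have hsum : ∑ x ∈ s k, κ' x = ∑ y ∈ s (k + 1), κ₂ y :=
      Finset.sum_fiberwise_of_maps_to hmaps _
    have hm2 : (m' : ℝ≥0∞) + (∑ y ∈ s (k + 1), κ₂ y) Set.univ = m := by
      rw [← hm, h2, Measure.add_apply, h1.measure_univ]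
    have hle : m' ≤ m := by
      have : (m' : ℝ≥0∞) ≤ m := hm2 ▸ le_self_add
      exact_mod_cast this
    obtain ⟨l, rfl⟩ := Nat.exists_eq_add_of_le hle
    have hl : (∑ y ∈ s (k + 1), κ₂ y) Set.univ = l := by
      push_cast at hm2
      exact (ENNReal.add_right_inj (by simp)).1 hm2
    have hlcard : l ≤ (s (k + 1)).card := by
      have : (l : ℝ≥0∞) ≤ (s (k + 1)).card := by
        rw [← hl, Measure.finsetSum_apply]
        calc ∑ y ∈ s (k + 1), κ₂ y Set.univ ≤ ∑ y ∈ s (k + 1), 1 :=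
              Finset.sum_le_sum fun y _ => (h3 y).le
          _ = _ := by simp
      exact_mod_cast this
    have hdec := ih κ' (fun x => by rw [hκ']; infer_instance) l ?_ (by rw [hsum, hl])
    · rw [hsum] at hdec
      rw [h2]
      refine (h1.add hdec).mono ?_
      rw [Finset.sum_range_succ]
      have h7 : (l : ℝ) ≤ (s (k + 1)).card := by exact_mod_cast hlcard
      have h8 : (l : ℝ) * (2 * (D / 2 ^ k)) ≤ (s (k + 1)).card * (2 * (D / 2 ^ k)) :=
        mul_le_mul_of_nonneg_right h7 (by positivity)
      have h9 : 0 ≤ (l : ℝ) * (2 * (D / 2 ^ (k + 1))) := by positivity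
      push_cast
      rw [add_mul]
      linarith
    · intro x _
      rw [hκ', Measure.finsetSum_apply]
      refine Finset.sum_eq_zero fun y hy => ?_
      obtain ⟨hys, rfl⟩ := Finset.mem_filter.1 hy
      have h10 := hπ y (hsF _ hys)
      -- The factor 2 makes the radii reproduce: old radius `D/2^k` plus distance to the parent at
      -- most `D/2^k` gives `2D/2^k`.
      have h11 : 2 * (D / 2 ^ (k + 1)) = D / 2 ^ k := by rw [pow_succ]; field_simp
      have hsub : Metric.closedBall y (2 * (D / 2 ^ (k + 1))) ⊆
          Metric.closedBall (π y) (2 * (D / 2 ^ k)) :=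
        Metric.closedBall_subset_closedBall' (by linarith)
      exact measure_mono_null (Set.compl_subset_compl.2 hsub) (h4 y)

/-- Restrict to one ball at a time and continue with what lies outside it. -/
theorem exists_sum_restrict_of_cover (s : Finset X) {r : ℝ}
    (hmeas : ∀ x : X, MeasurableSet (Metric.closedBall x r)) :
    ∀ (κ : Measure X) [IsFiniteMeasure κ], κ (⋃ x ∈ s, Metric.closedBall x r)ᶜ = 0 →
      ∃ κ' : X → Measure X, (∀ x, IsFiniteMeasure (κ' x)) ∧
        (∀ x, κ' x (Metric.closedBall x r)ᶜ = 0) ∧ ∑ x ∈ s, κ' x = κ := by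
  classical
  induction s using Finset.induction_on with
  | empty =>
    intro κ _ h
    refine ⟨0, fun x => by simp only [Pi.zero_apply]; infer_instance, by simp, ?_⟩
    rw [Finset.sum_empty, eq_comm, ← Measure.measure_univ_eq_zero]
    simpa using h
  | insert a s ha ih =>
    intro κ _ h
    obtain ⟨κ', h1, h2, h3⟩ := ih (κ.restrict (Metric.closedBall a r)ᶜ) (by
      rw [Measure.restrict_apply' (hmeas a).compl, ← Set.compl_union, Set.union_comm]
      simpa using h)
    refine ⟨Function.update κ' a (κ.restrict (Metric.closedBall a r)), ?_, ?_, ?_⟩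
    · intro x
      by_cases hx : x = a
      · subst hx; simp only [Function.update_self]; infer_instance
      · simpa [hx] using h1 x
    · intro x
      by_cases hx : x = a
      · subst hx; simp [Measure.restrict_apply' (hmeas x)]
      · simpa [hx] using h2 x
    · have : ∑ x ∈ s, Function.update κ' a (κ.restrict (Metric.closedBall a r)) x
          = ∑ x ∈ s, κ' x :=
        Finset.sum_congr rfl fun x hx =>
          Function.update_of_ne (ne_of_mem_of_not_mem hx ha) _ _
      rw [Finset.sum_insert ha, this, h3, Function.update_self]
      exact Measure.restrict_add_restrict_compl (hmeas a)

end MassSplitting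

/-! ### Derandomised choice of the points. -/

section Selection

variable {X Θ : Type*} [MeasurableSpace X] [MeasurableSpace Θ]

/-- The centred indicator has mean zero, so the cross term with `a` disappears and only the
Bernoulli variance is added. -/
theorem lintegral_sq_add_indicator_sub (ν : Measure X) [IsProbabilityMeasure ν] {B : Set X}
    (hB : MeasurableSet B) (a : ℝ) :
    ∫⁻ x, ENNReal.ofReal ((a + (B.indicator (fun _ => (1 : ℝ)) x - ν.real B)) ^ 2) ∂ν =
      ENNReal.ofReal (a ^ 2) + ENNReal.ofReal (ν.real B * (1 - ν.real B)) := by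
  have h1 : ν.real B ≤ 1 := measureReal_le_one
  have h0 : 0 ≤ ν.real B := measureReal_nonneg
  have hi : Integrable (B.indicator fun _ => (1 : ℝ)) ν := (integrable_const 1).indicator hB
  have heq : ∀ x, (a + (B.indicator (fun _ => (1 : ℝ)) x - ν.real B)) ^ 2 =
      (a - ν.real B) ^ 2 + B.indicator (fun _ => (1 : ℝ)) x * (1 + 2 * (a - ν.real B)) := by
    intro x
    by_cases hx : x ∈ B
    · simp only [Set.indicator_of_mem hx]; ring
    · simp only [Set.indicator_of_notMem hx]; ring
  rw [← ENNReal.ofReal_add (sq_nonneg _) (mul_nonneg h0 (by linarith)),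
    ← ofReal_integral_eq_lintegral_ofReal _ (Filter.Eventually.of_forall fun x => sq_nonneg _)]
  · congr 1
    simp_rw [heq]
    rw [integral_add (integrable_const _) (hi.mul_const _), integral_mul_const,
      integral_indicator hB]
    simp
    ring
  · simp_rw [heq]
    exact (integrable_const _).add (hi.mul_const _)

/-- One point can be drawn from each of the measures `ν j` in such a way that the quadratic
discrepancy is at most the sum of the variances. -/
theorem exists_points_lintegral_sq_le (τ : Measure Θ) [SFinite τ] {F : Set X} {A : Set (X × Θ)}
    (hA : MeasurableSet A) {m : ℕ} (ν : Fin m → Measure X) [∀ j, IsProbabilityMeasure (ν j)]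
    (hF : ∀ j, ν j Fᶜ = 0) :
    ∃ ζ : Fin m → X, (∀ j, ζ j ∈ F) ∧
      ∫⁻ θ, ENNReal.ofReal ((∑ j, (((fun x => (x, θ)) ⁻¹' A).indicator (fun _ => (1 : ℝ)) (ζ j) -
          (ν j).real ((fun x => (x, θ)) ⁻¹' A))) ^ 2) ∂τ ≤
        ∑ j, ∫⁻ θ, ENNReal.ofReal ((ν j).real ((fun x => (x, θ)) ⁻¹' A) *
          (1 - (ν j).real ((fun x => (x, θ)) ⁻¹' A))) ∂τ := by
  have hsec : ∀ θ, MeasurableSet ((fun x : X => (x, θ)) ⁻¹' A) := fun θ =>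
    measurable_prodMk_right hA
  have hv : ∀ (ν : Measure X) [IsProbabilityMeasure ν],
      Measurable fun θ => ν.real ((fun x => (x, θ)) ⁻¹' A) := fun ν _ =>
    (measurable_measure_prodMk_right hA).ennreal_toReal
  have hind : Measurable fun q : X × Θ =>
      ((fun x => (x, q.2)) ⁻¹' A).indicator (fun _ => (1 : ℝ)) q.1 :=
    measurable_const.indicator hA
  induction m with
  | zero => exact ⟨Fin.elim0, fun j => j.elim0, by simp⟩
  | succ m ih =>
    obtain ⟨ζ, hζF, hζ⟩ := ih (fun j => ν j.castSucc) fun j => hF _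
    set S : Θ → ℝ := fun θ => ∑ j : Fin m,
      (((fun x => (x, θ)) ⁻¹' A).indicator (fun _ => (1 : ℝ)) (ζ j) -
        (ν j.castSucc).real ((fun x => (x, θ)) ⁻¹' A)) with hS
    have hSm : Measurable S := by
      refine Finset.measurable_sum _ fun j _ => Measurable.sub ?_ (hv _)
      exact hind.comp measurable_prodMk_left
    set ν' := ν (Fin.last m)
    set G : X → Θ → ℝ≥0∞ := fun x θ => ENNReal.ofReal ((S θ +
      (((fun x => (x, θ)) ⁻¹' A).indicator (fun _ => (1 : ℝ)) x -
        ν'.real ((fun x => (x, θ)) ⁻¹' A))) ^ 2) with hG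
    have hGm : Measurable (Function.uncurry G) := by
      refine ENNReal.measurable_ofReal.comp (Measurable.pow_const ?_ 2)
      exact (hSm.comp measurable_snd).add (hind.sub ((hv ν').comp measurable_snd))
    -- With the earlier points fixed, some `x` outside the null set `Fᶜ` does no worse than the
    -- average over `ν'`.
    obtain ⟨x, hxF, hx⟩ := exists_notMem_null_le_lintegral (μ := ν')
      (f := fun x => ∫⁻ θ, G x θ ∂τ) hGm.lintegral_prod_right'.aemeasurable (hF (Fin.last m))
    refine ⟨Fin.snoc ζ x, fun j => ?_, ?_⟩
    · refine Fin.lastCases ?_ (fun i => ?_) j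
      · simpa using hxF
      · simpa using hζF i
    · simp only [Fin.sum_univ_castSucc, Fin.snoc_castSucc, Fin.snoc_last]
      refine hx.trans ?_
      rw [lintegral_lintegral_swap hGm.aemeasurable]
      simp only [hG]
      simp_rw [lintegral_sq_add_indicator_sub ν' (hsec _)]
      rw [lintegral_add_left (f := fun θ => ENNReal.ofReal (S θ ^ 2))
        (ENNReal.measurable_ofReal.comp (hSm.pow_const 2))]
      exact add_le_add hζ le_rfl

end Selection

/-! ### The cylinder metric and the discrepancy bound. -/

noncomputable section

namespace Heisenberg

variable {n : ℕ}

theorem cnorm_eq_norm (z : Fin n → ℂ) : cnorm z = ‖WithLp.toLp 2 z‖ := by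
  rw [EuclideanSpace.norm_eq]; rfl

theorem cnorm_nonneg (z : Fin n → ℂ) : 0 ≤ cnorm z := Real.sqrt_nonneg _

theorem cnorm_add_le (z w : Fin n → ℂ) : cnorm (z + w) ≤ cnorm z + cnorm w := by
  simp only [cnorm_eq_norm, WithLp.toLp_add]
  exact norm_add_le _ _

theorem abs_herm_im_le (z w : Fin n → ℂ) : |(herm z w).im| ≤ cnorm z * cnorm w := by
  refine (Complex.abs_im_le_norm _).trans ?_
  refine (norm_sum_le _ _).trans ?_
  simp only [norm_mul, norm_star]
  exact Real.sum_mul_le_sqrt_mul_sqrt _ _ _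

/-- The homogeneous norm `max(|z|, |t|^{1/2})`, whose balls are the cylinders. -/
def cylNorm (p : Heisenberg n) : ℝ := max (cnorm p.z) (Real.sqrt |p.t|)

theorem cylNorm_nonneg (p : Heisenberg n) : 0 ≤ cylNorm p :=
  (cnorm_nonneg _).trans (le_max_left _ _)

theorem cylNorm_le_iff {p : Heisenberg n} {ρ : ℝ} (hρ : 0 ≤ ρ) :
    cylNorm p ≤ ρ ↔ p ∈ cyl n ρ := by
  rw [cylNorm, max_le_iff, Real.sqrt_le_left hρ]
  rfl

theorem cylNorm_one : cylNorm (1 : Heisenberg n) = 0 := by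
  simp [cylNorm, cnorm]

theorem cylNorm_inv (p : Heisenberg n) : cylNorm p⁻¹ = cylNorm p := by
  simp [cylNorm, cnorm]

/-- With `a`, `b` the two norms, the `t`-component is at most `a² + b² + ab/2 ≤ (a + b)²`, thanks to
the small factor `1/2` in the group law. -/
theorem cylNorm_mul_le (p q : Heisenberg n) : cylNorm (p * q) ≤ cylNorm p + cylNorm q := by
  have hp := cylNorm_nonneg p
  have hq := cylNorm_nonneg q
  obtain ⟨hpz, hpt⟩ := (cylNorm_le_iff hp).1 le_rfl
  obtain ⟨hqz, hqt⟩ := (cylNorm_le_iff hq).1 le_rfl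
  refine (cylNorm_le_iff (add_nonneg hp hq)).2 ⟨?_, ?_⟩
  · exact (cnorm_add_le _ _).trans (add_le_add hpz hqz)
  · have h1 := (abs_herm_im_le p.z q.z).trans
      (mul_le_mul hpz hqz (cnorm_nonneg _) hp)
    rw [t_mul]
    rw [abs_le] at *
    constructor <;> nlinarith [mul_nonneg hp hq]

theorem cylNorm_le_koranyi (p : Heisenberg n) : cylNorm p ≤ koranyi p := by
  have key : ∀ x : ℝ, 0 ≤ x → x ^ 4 ≤ cnorm p.z ^ 4 + p.t ^ 2 → x ≤ koranyi p := by
    intro x hx h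
    have h2 : x = (x ^ 4) ^ (1 / 4 : ℝ) := by
      rw [← Real.rpow_natCast, ← Real.rpow_mul hx]; norm_num
    rw [h2]
    exact Real.rpow_le_rpow (by positivity) h (by norm_num)
  refine max_le (key _ (cnorm_nonneg _) (by nlinarith [sq_nonneg p.t])) (key _ (by positivity) ?_)
  have : Real.sqrt |p.t| ^ 4 = p.t ^ 2 := by
    rw [show 4 = 2 * 2 from rfl, pow_mul, Real.sq_sqrt (abs_nonneg _), sq_abs]
  rw [this]
  have := pow_nonneg (cnorm_nonneg p.z) 4
  linarith

/-- The left-invariant metric whose balls are the translated cylinders. -/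
instance instPseudoMetricSpace : PseudoMetricSpace (Heisenberg n) where
  dist p q := cylNorm (p⁻¹ * q)
  dist_self p := by simp [cylNorm_one]
  dist_comm p q := by rw [← cylNorm_inv]; simp
  dist_triangle p q r := by
    have := cylNorm_mul_le (p⁻¹ * q) (q⁻¹ * r)
    rwa [mul_assoc, mul_inv_cancel_left] at this

theorem dist_def (p q : Heisenberg n) : dist p q = cylNorm (p⁻¹ * q) := rfl

theorem dist_le_kdist (p q : Heisenberg n) : dist p q ≤ kdist p q := cylNorm_le_koranyi _

theorem translatedCyl_eq_closedBall (p : Heisenberg n) {ρ : ℝ} (hρ : 0 ≤ ρ) :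
    translatedCyl p ρ = Metric.closedBall p ρ := by
  ext q
  rw [Metric.mem_closedBall, dist_comm, dist_def, cylNorm_le_iff hρ]
  rfl

theorem measurable_z : Measurable (z : Heisenberg n → Fin n → ℂ) := measurable_fst

theorem measurable_t : Measurable (t : Heisenberg n → ℝ) := measurable_snd

theorem measurable_cnorm : Measurable (cnorm : (Fin n → ℂ) → ℝ) := by
  unfold cnorm; fun_prop

theorem measurable_inv_mul_z :
    Measurable fun q : Heisenberg n × Heisenberg n => (q.1⁻¹ * q.2).z :=
  (measurable_z.comp measurable_fst).neg.add (measurable_z.comp measurable_snd)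

theorem measurable_inv_mul_t :
    Measurable fun q : Heisenberg n × Heisenberg n => (q.1⁻¹ * q.2).t := by
  have h1 : Measurable fun q : Heisenberg n × Heisenberg n => q.1.z :=
    measurable_z.comp measurable_fst
  have h2 : Measurable fun q : Heisenberg n × Heisenberg n => q.2.z :=
    measurable_z.comp measurable_snd
  have h3 : Measurable fun q : Heisenberg n × Heisenberg n => (herm (q.1⁻¹).z q.2.z).im := by
    simp only [herm, z_inv, Pi.neg_apply, Complex.star_def]
    fun_prop
  exact ((measurable_t.comp measurable_fst).neg.add (measurable_t.comp measurable_snd)).add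
    (h3.const_mul _)

theorem measurable_dist_prod :
    Measurable fun q : Heisenberg n × Heisenberg n => dist q.1 q.2 :=
  (measurable_cnorm.comp measurable_inv_mul_z).max
    (continuous_abs.measurable.comp measurable_inv_mul_t).sqrt

theorem measurable_kdist_prod :
    Measurable fun q : Heisenberg n × Heisenberg n => kdist q.1 q.2 :=
  (((measurable_cnorm.comp measurable_inv_mul_z).pow_const 4).add
    (measurable_inv_mul_t.pow_const 2)).pow_const _

theorem measurableSet_kball (p : Heisenberg n) (r : ℝ) : MeasurableSet (kball p r) := by
  have h : Measurable fun q : Heisenberg n => (p, q) := measurable_const.prodMk measurable_id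
  have h' := measurable_kdist_prod.comp h
  exact measurableSet_lt h' measurable_const

theorem measurableSet_closedBall (p : Heisenberg n) (r : ℝ) :
    MeasurableSet (Metric.closedBall p r) := by
  have h : Measurable fun q : Heisenberg n => (q, p) := measurable_id.prodMk measurable_const
  have h' := measurable_dist_prod.comp h
  exact measurableSet_le h' measurable_const

instance instSFinite : SFinite (volume : Measure (Heisenberg n)) :=
  inferInstanceAs (SFinite (volume : Measure ((Fin n → ℂ) × ℝ)))

theorem measurableSet_dist_le :
    MeasurableSet {q : Heisenberg n × (ℝ × Heisenberg n) | dist q.1 q.2.2 ≤ q.2.1} := by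
  have h : Measurable fun q : Heisenberg n × (ℝ × Heisenberg n) => (q.1, q.2.2) :=
    measurable_fst.prodMk (measurable_snd.comp measurable_snd)
  have h' := measurable_dist_prod.comp h
  exact measurableSet_le h' (measurable_fst.comp measurable_snd)

theorem measurable_measureReal_closedBall (ν : Measure (Heisenberg n)) [SFinite ν] :
    Measurable fun θ : ℝ × Heisenberg n => ν.real (Metric.closedBall θ.2 θ.1) := by
  have h := measurable_measure_prodMk_right (μ := ν) measurableSet_dist_le
  exact h.ennreal_toReal

theorem measurable_indicator_closedBall (x : Heisenberg n) :
    Measurable fun θ : ℝ × Heisenberg n =>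
      (Metric.closedBall θ.2 θ.1).indicator (fun _ => (1 : ℝ)) x := by
  have h : Measurable fun θ : ℝ × Heisenberg n => (x, θ) := measurable_const.prodMk measurable_id
  classical
  simp only [Set.indicator_apply, Metric.mem_closedBall]
  exact Measurable.ite (h measurableSet_dist_le) measurable_const measurable_const

/-- Unless `|ρ - dist c p| ≤ r`, the ball about `p` misses or contains the carrier of `ν`, and the
variance is zero; otherwise it is at most one. -/
theorem lintegral_variance_closedBall_le {ν : Measure (Heisenberg n)} [IsProbabilityMeasure ν]
    {c : Heisenberg n} {r : ℝ} (hν : ν (Metric.closedBall c r)ᶜ = 0) (p : Heisenberg n)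
    (T : Set ℝ) :
    ∫⁻ ρ in T, ENNReal.ofReal (ν.real (Metric.closedBall p ρ) *
      (1 - ν.real (Metric.closedBall p ρ))) ≤ ENNReal.ofReal (2 * r) := by
  calc ∫⁻ ρ in T, ENNReal.ofReal (ν.real (Metric.closedBall p ρ) *
      (1 - ν.real (Metric.closedBall p ρ)))
      ≤ ∫⁻ ρ, ENNReal.ofReal (ν.real (Metric.closedBall p ρ) *
      (1 - ν.real (Metric.closedBall p ρ))) := setLIntegral_le_lintegral _ _
    _ ≤ ∫⁻ ρ, (Set.Icc (dist c p - r) (dist c p + r)).indicator 1 ρ := by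
        refine lintegral_mono fun ρ => ?_
        by_cases hρ : ρ ∈ Set.Icc (dist c p - r) (dist c p + r)
        · rw [Set.indicator_of_mem hρ, Pi.one_apply, ENNReal.ofReal_le_one]
          nlinarith [sq_nonneg (ν.real (Metric.closedBall p ρ))]
        · rw [Set.indicator_of_notMem hρ, nonpos_iff_eq_zero, ENNReal.ofReal_eq_zero]
          rw [Set.mem_Icc, not_and_or, not_le, not_le] at hρ
          rcases hρ with hρ | hρ
          · have hsub : Metric.closedBall p ρ ⊆ (Metric.closedBall c r)ᶜ := by
              intro q hq hq'
              rw [Metric.mem_closedBall] at hq hq'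
              have := dist_triangle c q p
              rw [dist_comm c q] at this
              linarith
            have : ν.real (Metric.closedBall p ρ) = 0 := by
              simp [Measure.real, measure_mono_null hsub hν]
            simp [this]
          · have hsub : Metric.closedBall c r ⊆ Metric.closedBall p ρ :=
              Metric.closedBall_subset_closedBall' (by linarith)
            have h0 : ν (Metric.closedBall p ρ)ᶜ = 0 :=
              measure_mono_null (Set.compl_subset_compl.2 hsub) hν
            have : ν (Metric.closedBall p ρ) = 1 :=
              (prob_compl_eq_zero_iff (measurableSet_closedBall p ρ)).1 h0
            simp [Measure.real, this]
    _ = ENNReal.ofReal (2 * r) := by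
        rw [lintegral_indicator_one measurableSet_Icc, Real.volume_Icc]
        congr 1; ring

/-- A decomposition of `N μ` into unit masses carried by balls of total radius `R` yields points
of quadratic discrepancy at most `2 R`. -/
theorem exists_quadDiscrepancy_le {F : Set (Heisenberg n)}
    (hF : NullMeasurableSet F (volume : Measure (Heisenberg n)))
    (hF1 : (volume : Measure (Heisenberg n)) F = 1) {N : ℕ} {R : ℝ}
    (h : HasUnitDecomposition ((N : ℝ≥0∞) • (volume : Measure (Heisenberg n)).restrict F) N R) :
    ∃ ζ : Fin N → Heisenberg n, (∀ j, ζ j ∈ F) ∧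
      quadDiscrepancy F ζ ≤ ENNReal.ofReal (2 * R) := by
  obtain ⟨ν, c, r, h1, h2, h3, h4, h5⟩ := h
  set T : Set ℝ := {ρ : ℝ | 0 < ρ ∧ ENNReal.ofReal ρ < kdiam F} with hT
  have hTm : MeasurableSet T :=
    measurableSet_Ioi.inter (measurableSet_lt ENNReal.measurable_ofReal measurable_const)
  have hνF : ∀ j, ν j Fᶜ = 0 := by
    intro j
    have hle : ν j Fᶜ ≤ (∑ j, ν j) Fᶜ := by
      rw [Measure.finsetSum_apply]
      exact Finset.single_le_sum (f := fun j => ν j Fᶜ) (fun _ _ => zero_le) (Finset.mem_univ j)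
    have h0 : (volume.restrict F) Fᶜ = 0 :=
      mem_ae_iff.1 (ae_restrict_mem₀ hF)
    rw [h5, Measure.smul_apply, h0, smul_zero] at hle
    exact nonpos_iff_eq_zero.1 hle
  -- This turns the discrepancy into a sum of centred indicators.
  have hsum : ∀ B, ∑ j, (ν j).real B = N * (volume.restrict F).real B := by
    intro B
    have := congrArg (fun κ : Measure (Heisenberg n) => (κ B).toReal) h5
    simp only [Measure.finsetSum_apply, Measure.smul_apply, smul_eq_mul, ENNReal.toReal_mul,
      ENNReal.toReal_natCast] at this
    rw [ENNReal.toReal_sum fun j _ => measure_ne_top _ _] at this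
    exact this
  obtain ⟨ζ, hζF, hζ⟩ := exists_points_lintegral_sq_le
    ((volume.restrict T).prod ((volume : Measure (Heisenberg n)).restrict F))
    measurableSet_dist_le ν hνF
  have hsec : ∀ θ : ℝ × Heisenberg n, ((fun x : Heisenberg n => (x, θ)) ⁻¹'
      {q : Heisenberg n × (ℝ × Heisenberg n) | dist q.1 q.2.2 ≤ q.2.1}) =
        Metric.closedBall θ.2 θ.1 := fun θ => rfl
  simp only [hsec] at hζ
  refine ⟨ζ, hζF, ?_⟩
  calc quadDiscrepancy F ζ
      = ∫⁻ ρ in T, ∫⁻ p in F, ENNReal.ofReal ((∑ j,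
          ((Metric.closedBall p ρ).indicator (fun _ => (1 : ℝ)) (ζ j) -
            (ν j).real (Metric.closedBall p ρ))) ^ 2) := by
        refine setLIntegral_congr_fun hTm fun ρ hρ => ?_
        refine lintegral_congr fun p => ?_
        rw [discrepancy, translatedCyl_eq_closedBall p hρ.1.le, sq_abs, Finset.sum_sub_distrib,
          hsum]
    _ = ∫⁻ θ, ENNReal.ofReal ((∑ j,
          ((Metric.closedBall θ.2 θ.1).indicator (fun _ => (1 : ℝ)) (ζ j) -
            (ν j).real (Metric.closedBall θ.2 θ.1))) ^ 2)
          ∂((volume.restrict T).prod ((volume : Measure (Heisenberg n)).restrict F)) := by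
        rw [lintegral_prod]
        refine (ENNReal.measurable_ofReal.comp (Measurable.pow_const ?_ 2)).aemeasurable
        refine Finset.measurable_sum _ fun j _ => 
          (measurable_indicator_closedBall (ζ j)).sub (measurable_measureReal_closedBall (ν j))
    _ ≤ ∑ j, ENNReal.ofReal (2 * r j) := by
        refine hζ.trans (Finset.sum_le_sum fun j _ => ?_)
        have hm := measurable_measureReal_closedBall (ν j)
        have hm' := ENNReal.measurable_ofReal.comp (hm.mul (hm.const_sub 1))
        -- The variance bound needs `p` fixed and `ρ` integrated first.
        refine (lintegral_prod_symm _ hm'.aemeasurable).trans_le ?_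
        calc _ ≤ ∫⁻ _p in F, ENNReal.ofReal (2 * r j) :=
              lintegral_mono fun p => lintegral_variance_closedBall_le (h2 j) p T
          _ = _ := by simp [hF1]
    _ = ENNReal.ofReal (2 * ∑ j, r j) := by
        rw [← ENNReal.ofReal_sum_of_nonneg fun j _ => by have := h3 j; positivity,
          Finset.mul_sum]
    _ ≤ ENNReal.ofReal (2 * R) := ENNReal.ofReal_le_ofReal (by linarith)

end Heisenberg

end

/-! ### Choice of scale and total radius, with `q = Q - 1`. -/

theorem sum_card_mul_le {q : ℕ} (hq : 1 ≤ q) {D M : ℝ} (hD : 0 ≤ D) (hM : 0 ≤ M) (a : ℕ → ℕ)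
    (ha : ∀ k, (a (k + 1) : ℝ) ≤ M * (2 ^ (k + 1)) ^ (q + 1)) (k : ℕ) :
    ∑ i ∈ Finset.range k, (a (i + 1) : ℝ) * (2 * (D / 2 ^ i)) ≤ 8 * D * M * (2 ^ k) ^ q := by
  induction k with
  | zero => simp; positivity
  | succ k ih =>
    rw [Finset.sum_range_succ]
    have h1 : (a (k + 1) : ℝ) * (2 * (D / 2 ^ k)) ≤ 4 * D * M * (2 ^ (k + 1)) ^ q := by
      calc (a (k + 1) : ℝ) * (2 * (D / 2 ^ k))
          ≤ M * (2 ^ (k + 1)) ^ (q + 1) * (2 * (D / 2 ^ k)) :=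
            mul_le_mul_of_nonneg_right (ha k) (by positivity)
        _ = 4 * D * M * (2 ^ (k + 1)) ^ q := by
            rw [pow_succ _ q, pow_succ 2 k]; field_simp; ring
    have h2 : 8 * D * M * (2 ^ k) ^ q ≤ 4 * D * M * (2 ^ (k + 1)) ^ q := by
      have h3 : (2 : ℝ) ≤ 2 ^ q := by
        simpa using pow_le_pow_right₀ (one_le_two (α := ℝ)) hq
      rw [pow_succ 2 k, mul_pow]
      have h4 : 0 ≤ 4 * D * M * (2 ^ k) ^ q := by positivity
      nlinarith
    linarith

theorem exists_scale_bound (q : ℕ) {N : ℕ} (hN : 1 ≤ N) :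
    ∃ K : ℕ, (N : ℝ) / 2 ^ K ≤ 2 ^ (q + 1) * (2 ^ K) ^ q ∧
      ((2 : ℝ) ^ K) ^ q ≤ (N : ℝ) ^ (1 - 1 / ((q + 1 : ℕ) : ℝ)) := by
  have hb : 1 < 2 ^ (q + 1) := Nat.one_lt_two_pow (by omega)
  -- Thus `2^(KQ) ≤ N < 2^((K+1)Q)`: about one unit of mass per point of the finest net.
  set K := Nat.log (2 ^ (q + 1)) N with hK
  refine ⟨K, ?_, ?_⟩
  · have h1 : (N : ℝ) ≤ (2 ^ (q + 1)) ^ (K + 1) := by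
      exact_mod_cast (Nat.lt_pow_succ_log_self hb N).le
    rw [div_le_iff₀ (by positivity)]
    refine h1.trans_eq ?_
    ring
  · have h1 : ((2 : ℝ) ^ K) ^ (q + 1) ≤ N := by
      rw [pow_right_comm]
      exact_mod_cast Nat.pow_log_le_self (2 ^ (q + 1)) (by omega)
    have h2 : (((2 : ℝ) ^ K) ^ (q + 1)) ^ (1 - 1 / ((q + 1 : ℕ) : ℝ)) = (2 ^ K) ^ q := by
      rw [← Real.rpow_natCast _ (q + 1), ← Real.rpow_mul (by positivity),
        ← Real.rpow_natCast _ q]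
      congr 1
      push_cast
      field_simp
      ring
    rw [← h2]
    refine Real.rpow_le_rpow (by positivity) h1 ?_
    rw [sub_nonneg, div_le_one (by positivity)]
    exact_mod_cast Nat.le_add_left 1 q

theorem hasUnitDecomposition_smul {X : Type*} [PseudoMetricSpace X] [MeasurableSpace X]
    (hmeas : ∀ (x : X) (r : ℝ), MeasurableSet (Metric.closedBall x r)) {F : Set X} {D M : ℝ}
    (hD : 0 ≤ D) (hM : 0 ≤ M) {q : ℕ} (hq : 1 ≤ q) {x₀ : X} (hx₀ : x₀ ∈ F)
    (hFD : F ⊆ Metric.closedBall x₀ D)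
    (hnet : ∀ k : ℕ, ∀ s : Finset X, ↑s ⊆ F →
      (∀ x ∈ s, ∀ y ∈ s, x ≠ y → D / 2 ^ k ≤ dist x y) →
        (s.card : ℝ) ≤ M * (2 ^ k) ^ (q + 1))
    (μ : Measure X) [IsProbabilityMeasure μ] (hμ : μ Fᶜ = 0) {N : ℕ} (hN : 1 ≤ N) :
    HasUnitDecomposition ((N : ℝ≥0∞) • μ) N
      ((2 ^ (q + 2) * D + 8 * D * M) * (N : ℝ) ^ (1 - 1 / ((q + 1 : ℕ) : ℝ))) := by
  have hex : ∀ k : ℕ, ∃ s : Finset X, ↑s ⊆ F ∧ (s.card : ℝ) ≤ M * (2 ^ k) ^ (q + 1) ∧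
      ∀ y ∈ F, ∃ x ∈ s, dist y x ≤ D / 2 ^ k := by
    intro k
    obtain ⟨s, h1, h2, h3⟩ := exists_finset_net_of_card_le (F := F) (δ := D / 2 ^ k)
      (M := ⌊M * (2 ^ k) ^ (q + 1)⌋₊) (by positivity)
      (fun s hs hsep => Nat.le_floor (hnet k s hs hsep))
    exact ⟨s, h1, (Nat.cast_le.2 h2).trans (Nat.floor_le (by positivity)), h3⟩
  choose s' h1 h2 h3 using hex
  -- The coarsest net is forced to be one point, as the root of the recursion requires.
  set s : ℕ → Finset X := fun k => if k = 0 then {x₀} else s' k with hs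
  have hs0 : (s 0).card = 1 := by simp [hs]
  have hsucc : ∀ k, s (k + 1) = s' (k + 1) := fun k => by simp [hs]
  have hsF : ∀ k, ↑(s k) ⊆ F := by
    rintro (_ | k)
    · simpa [hs] using hx₀
    · rw [hsucc]; exact h1 _
  have hcov : ∀ k, ∀ y ∈ F, ∃ x ∈ s k, dist y x ≤ D / 2 ^ k := by
    rintro (_ | k) y hy
    · exact ⟨x₀, by simp [hs], by simpa using hFD hy⟩
    · rw [hsucc]; exact h3 _ y hy
  obtain ⟨K, hK1, hK2⟩ := exists_scale_bound q hN
  have : IsFiniteMeasure ((N : ℝ≥0∞) • μ) := ⟨by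
    rw [Measure.smul_apply, measure_univ]; simp⟩
  have hsub : F ⊆ ⋃ x ∈ s K, Metric.closedBall x (2 * (D / 2 ^ K)) := by
    intro y hy
    obtain ⟨x, hx, hyx⟩ := hcov K y hy
    have h0 : 0 ≤ D / 2 ^ K := by positivity
    exact Set.mem_biUnion hx (Metric.mem_closedBall.2 (by linarith))
  obtain ⟨κ, hκ1, hκ2, hκ3⟩ := exists_sum_restrict_of_cover (s K)
    (fun x => hmeas x (2 * (D / 2 ^ K))) ((N : ℝ≥0∞) • μ) (by
      rw [Measure.smul_apply, measure_mono_null (Set.compl_subset_compl.2 hsub) hμ, smul_zero])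
  have hdec := hasUnitDecomposition_of_nets hD s hs0 hsF hcov K κ hκ1 N (fun x _ => hκ2 x)
    (by rw [hκ3, Measure.smul_apply, measure_univ]; simp)
  rw [hκ3] at hdec
  refine hdec.mono ?_
  have hsum := sum_card_mul_le hq hD hM (fun k => (s k).card)
    (fun k => by rw [hsucc]; exact h2 _) K
  calc _ ≤ 2 * D * ((N : ℝ) / 2 ^ K) + 8 * D * M * (2 ^ K) ^ q := by
        refine add_le_add (le_of_eq ?_) hsum
        ring
    _ ≤ 2 * D * (2 ^ (q + 1) * (2 ^ K) ^ q) + 8 * D * M * (2 ^ K) ^ q := by gcongr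
    _ = (2 ^ (q + 2) * D + 8 * D * M) * (2 ^ K) ^ q := by ring
    _ ≤ _ := by gcongr

/-! ### Consequences of regularity and the conclusion. -/

namespace Heisenberg

variable {n : ℕ}

theorem kdiam_ne_top_of_isAhlforsRegularOn {F : Set (Heisenberg n)}
    {μ : Measure (Heisenberg n)} [IsProbabilityMeasure μ] (hne : F.Nonempty)
    (h : IsAhlforsRegularOn μ F) : kdiam F ≠ ⊤ := by
  obtain ⟨c₁, c₂, hc₁, -, h⟩ := h
  obtain ⟨x, hx⟩ := hne
  intro htop
  -- For infinite diameter this radius is admissible, yet `c₁ r^Q ≥ c₁ r ≥ 2` exceeds the total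
  -- mass.
  set r : ℝ := max 1 (2 / c₁) with hr
  have hr1 : 1 ≤ r := le_max_left _ _
  have h1 := (h x hx r (by linarith) (by simp [htop])).1.trans prob_le_one
  rw [ENNReal.ofReal_le_one] at h1
  have h2 : r ≤ r ^ homDim n := le_self_pow₀ hr1 (by simp [homDim])
  have h3 : 2 ≤ c₁ * r := by
    rw [← div_le_iff₀' hc₁]; exact le_max_right _ _
  nlinarith

/-- A packing argument: `kdist` dominates `dist`, so Korányi balls of radius `r` about
`2r`-separated points are disjoint, and their masses add up to at most one. -/
theorem card_le_of_separated {F : Set (Heisenberg n)} {μ : Measure (Heisenberg n)}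
    [IsProbabilityMeasure μ] {c r : ℝ} (hc : 0 < c) (hr : 0 < r)
    (h : ∀ p ∈ F, ENNReal.ofReal (c * r ^ homDim n) ≤ μ (kball p r)) (s : Finset (Heisenberg n))
    (hs : ↑s ⊆ F) (hsep : ∀ x ∈ s, ∀ y ∈ s, x ≠ y → 2 * r ≤ dist x y) :
    (s.card : ℝ) * (c * r ^ homDim n) ≤ 1 := by
  have hdisj : (s : Set (Heisenberg n)).PairwiseDisjoint fun x => kball x r := by
    intro x hx y hy hxy
    refine Set.disjoint_left.2 fun w hwx hwy => ?_
    have h1 := (dist_le_kdist x w).trans_lt hwx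
    have h2 := (dist_le_kdist y w).trans_lt hwy
    have h3 := hsep x hx y hy hxy
    have h4 := dist_triangle_right x y w
    linarith
  have h1 : ∑ x ∈ s, μ (kball x r) ≤ 1 := by
    rw [← measure_biUnion_finset hdisj fun x _ => measurableSet_kball x r]
    exact prob_le_one
  have h2 : ∑ x ∈ s, ENNReal.ofReal (c * r ^ homDim n) ≤ 1 :=
    (Finset.sum_le_sum fun x hx => h x (hs hx)).trans h1
  rw [← ENNReal.ofReal_sum_of_nonneg fun _ _ => by positivity, ENNReal.ofReal_le_one] at h2
  simpa using h2

theorem quadDiscrepancy_eq_zero_of_kdiam {F : Set (Heisenberg n)} (h : kdiam F = 0) {N : ℕ}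
    (ζ : Fin N → Heisenberg n) : quadDiscrepancy F ζ = 0 := by
  simp [quadDiscrepancy, h]

end Heisenberg

theorem mainTheorem2 (n : ℕ) (hn : 1 ≤ n) (F : Set (Heisenberg n))
    (hF : NullMeasurableSet F (volume : Measure (Heisenberg n)))
    (hF1 : (volume : Measure (Heisenberg n)) F = 1)
    (hreg : Heisenberg.IsAhlforsRegularOn
      ((volume : Measure (Heisenberg n)).restrict F) F) :
    ∃ C : ℝ, 0 < C ∧ ∃ N₀ : ℕ, ∀ N : ℕ, N₀ ≤ N →
      ∃ ζ : Fin N → Heisenberg n, (∀ j, ζ j ∈ F) ∧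
        Heisenberg.quadDiscrepancy F ζ ≤
          ENNReal.ofReal (C * (N : ℝ) ^ (1 - 1 / (Heisenberg.homDim n : ℝ))) := by
  have : IsProbabilityMeasure ((volume : Measure (Heisenberg n)).restrict F) :=
    ⟨by rw [Measure.restrict_apply_univ, hF1]⟩
  obtain ⟨x₀, hx₀⟩ : F.Nonempty := by
    rw [Set.nonempty_iff_ne_empty]; rintro rfl; simp at hF1
  have htop := Heisenberg.kdiam_ne_top_of_isAhlforsRegularOn ⟨x₀, hx₀⟩ hreg
  by_cases hzero : Heisenberg.kdiam F = 0
  · exact ⟨1, one_pos, 1, fun N _ => ⟨fun _ => x₀, fun _ => hx₀, by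
      rw [Heisenberg.quadDiscrepancy_eq_zero_of_kdiam hzero]; exact zero_le⟩⟩
  set D := (Heisenberg.kdiam F).toReal with hD
  have hD0 : 0 < D := ENNReal.toReal_pos hzero htop
  obtain ⟨c₁, c₂, hc₁, -, hball⟩ := hreg
  -- The packing bound `1 / (c₁ r^Q)` at `r = D / 2^(k+1)` equals `M * 2^(kQ)`.
  set M : ℝ := (2 / D) ^ Heisenberg.homDim n / c₁ with hM
  have hM0 : 0 ≤ M := by positivity
  have hFD : F ⊆ Metric.closedBall x₀ D := by
    intro y hy
    have h1 : ENNReal.ofReal (Heisenberg.kdist y x₀) ≤ Heisenberg.kdiam F :=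
      (le_iSup₂ (f := fun q (_ : q ∈ F) => ENNReal.ofReal (Heisenberg.kdist y q)) x₀ hx₀).trans
        (le_iSup₂ (f := fun p (_ : p ∈ F) => ⨆ q ∈ F, ENNReal.ofReal (Heisenberg.kdist p q)) y hy)
    exact Metric.mem_closedBall.2 ((Heisenberg.dist_le_kdist y x₀).trans
      ((ENNReal.ofReal_le_iff_le_toReal htop).1 h1))
  have hnet : ∀ k : ℕ, ∀ s : Finset (Heisenberg n), ↑s ⊆ F →
      (∀ x ∈ s, ∀ y ∈ s, x ≠ y → D / 2 ^ k ≤ dist x y) →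
        (s.card : ℝ) ≤ M * (2 ^ k) ^ (2 * n + 1 + 1) := by
    intro k s hs hsep
    have hr : 0 < D / 2 ^ k / 2 := by positivity
    have hrD : D / 2 ^ k / 2 < D := by
      have : D / 2 ^ k ≤ D := div_le_self hD0.le (one_le_pow₀ one_le_two)
      linarith
    have h1 := Heisenberg.card_le_of_separated hc₁ hr (fun p hp => (hball p hp _ hr
      ((ENNReal.ofReal_lt_iff_lt_toReal hr.le htop).2 hrD)).1) s hs
      (fun x hx y hy hxy => by have := hsep x hx y hy hxy; linarith)
    rw [← le_div_iff₀ (by positivity)] at h1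
    refine h1.trans_eq ?_
    rw [hM, show 2 * n + 1 + 1 = Heisenberg.homDim n from rfl, div_div, div_pow, div_pow, mul_pow]
    field_simp
  -- Twice the total radius: the first term comes from the finest level, the second from the
  -- remainders.
  refine ⟨2 * (2 ^ (2 * n + 1 + 2) * D + 8 * D * M), by positivity, 1, fun N hN => ?_⟩
  have hdec := hasUnitDecomposition_smul Heisenberg.measurableSet_closedBall hD0.le hM0
    (q := 2 * n + 1) (by omega) hx₀ hFD hnet ((volume : Measure (Heisenberg n)).restrict F)
    (mem_ae_iff.1 (ae_restrict_mem₀ hF)) hN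
  rw [mul_assoc]
  exact Heisenberg.exists_quadDiscrepancy_le hF hF1 hdec
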